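/- Let $m,n,d,r\ge 0$ be integers, and let $\sigma_c\ge 0$, $\delta\ge 0$ and $\varepsilon>0$ be real numbers. Let $\mathbf U\in\mathbb R^{m\times r}$ have orthonormal columns, and let $\mathbf A=\mathbf U\mathbf M\in\mathbb R^{m\times n}$ and $\mathbf C=\mathbf U\mathbf W\in\mathbb R^{m\times d}$, where $\mathbf M\in\mathbb R^{r\times n}$ and $\mathbf W\in\mathbb R^{r\times d}$ both have full row rank $r$. Let $\tilde{\mathbf C}=\mathbf C+\mathbf G$, where the entries of the random matrix $\mathbf G\in\mathbb R^{m\times d}$ are i.i.d. $\mathcal N(0,\sigma_c^2)$ (identically $0$ almost surely if $\sigma_c=0$). Write $\sigma_{\min}(\mathbf C)$ for the smallest nonzero singular value of $\mathbf C$ (with the convention $\sigma_{\min}(\mathbf 0)=0$), $\mathbf P_{\tilde{\mathbf C}}\in\mathbb R^{m\times m}$ for the orthogonal projection onto the column span of $\tilde{\mathbf C}$, and $\|\cdot\|_F$ for the Frobenius norm. If \[ \sigma_{\min}(\mathbf C)\ \ge\ 2(1+\delta)\,\sigma_c\sqrt{m/\varepsilon}, \] then \[ \|(\mathbf I-\mathbf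 P_{\tilde{\mathbf C}})\mathbf A\|_F^2\ \le\ \varepsilon\,\|\mathbf A\|_F^2 \] with probability at least $1-\exp\left(-\tfrac{m\delta^2}{2}\right)$. -/

import Mathlib

open MeasureTheory ProbabilityTheory

/-! Throughout, the norm of a real matrix is the Frobenius norm. -/
attribute [local instance] Matrix.frobeniusNormedAddCommGroup

/-- The smallest nonzero singular value of a real matrix `C`, where the singular values are those
of `x ↦ C x` between Euclidean spaces (for `C = 0` the value is `0`). -/
noncomputable def sigmaMin {m d : ℕ} (C : Matrix (Fin m) (Fin d) ℝ) : ℝ :=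
  sInf {s : ℝ | s ≠ 0 ∧ ∃ i : ℕ, (Matrix.toEuclideanLin C).singularValues i = s}

/-- The column span of a real matrix `C`, as a subspace of Euclidean space. -/
noncomputable def colSpan {m d : ℕ} (C : Matrix (Fin m) (Fin d) ℝ) :
    Submodule ℝ (EuclideanSpace ℝ (Fin m)) :=
  Submodule.span ℝ (Set.range fun j : Fin d => WithLp.toLp 2 (C.col j))

/-- The matrix `P_C` of the orthogonal projection of Euclidean space onto the column span of
`C`. -/
noncomputable def colProj {m d : ℕ} (C : Matrix (Fin m) (Fin d) ℝ) :
    Matrix (Fin m) (Fin m) ℝ :=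
  Matrix.toEuclideanLin.symm ((colSpan C).starProjection : _ →ₗ[ℝ] _)

/-! Since `W` has a right inverse on the columns of `M`, `A = C * X`. Replace each column of `X` by
its minimal-norm representative `b j`, so that `C b j` is the `j`-th column of `A` and `sigmaMin C *
‖b j‖` is at most its norm. As `(C + G) b j` is killed by the residual projection, the error on
column `j` is at most `‖G b j‖` (`norm_residual_le`). The `b j` are deterministic, so only `∑ ‖G b
j‖ ^ 2` needs a tail bound. The summands may be dependent, but after normalisation the sum is a
convex combination of variables of one chi-square type; Jensen for `exp` reduces its exponential
moment to that of a single one, and Markov's inequality finishes. -/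

/-! ### Deterministic residual bound -/

/-- The projection of a vector to `(ker T)ᗮ` has the same image, and every lower bound on the
nonzero singular values controls its norm. -/
lemma LinearMap.exists_apply_eq_and_mul_norm_le {E F : Type*}
    [NormedAddCommGroup E] [InnerProductSpace ℝ E] [FiniteDimensional ℝ E]
    [NormedAddCommGroup F] [InnerProductSpace ℝ F] [FiniteDimensional ℝ F]
    (T : E →ₗ[ℝ] F) {s : ℝ} (hs : 0 ≤ s)
    (h : ∀ i : ℕ, T.singularValues i ≠ 0 → s ≤ T.singularValues i) (x : E) :
    ∃ b : E, T b = T x ∧ s * ‖b‖ ≤ ‖T x‖ := by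
  set b := T.kerᗮ.starProjection x with hb
  have hTb : T b = T x := by
    rw [hb, Submodule.starProjection_orthogonal']
    have : T (T.ker.starProjection x) = 0 :=
      LinearMap.mem_ker.1 (Submodule.starProjection_apply_mem _ _)
    simp [this]
  refine ⟨b, hTb, ?_⟩
  rw [← hTb]
  have hmem : b ∈ T.kerᗮ := Submodule.starProjection_apply_mem _ _
  have hT := T.isSymmetric_adjoint_comp_self
  set e := hT.eigenvectorBasis rfl
  have hsq : ‖T b‖ ^ 2 = ∑ i, hT.eigenvalues rfl i * inner ℝ (e i) b ^ 2 := by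
    rw [← real_inner_self_eq_norm_sq, ← LinearMap.adjoint_inner_left, ← LinearMap.comp_apply,
      ← e.sum_inner_mul_inner]
    refine Finset.sum_congr rfl fun i _ => ?_
    rw [hT, hT.apply_eigenvectorBasis, inner_smul_right, real_inner_comm]
    simp [e]
    ring
  have hterm : ∀ i, s ^ 2 * inner ℝ (e i) b ^ 2 ≤ hT.eigenvalues rfl i * inner ℝ (e i) b ^ 2 := by
    intro i
    by_cases h0 : T.singularValues i = 0
    · have hl : hT.eigenvalues rfl i = 0 := by
        rw [← T.sq_singularValues_fin rfl i, h0]; simp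
      -- Eigenvectors with eigenvalue zero lie in the kernel, to which `b` is orthogonal, so
      -- vanishing singular values contribute nothing.
      have hker : e i ∈ T.ker := by
        rw [LinearMap.mem_ker, ← norm_eq_zero, ← sq_eq_zero_iff, ← real_inner_self_eq_norm_sq,
          ← LinearMap.adjoint_inner_left, ← LinearMap.comp_apply, hT.apply_eigenvectorBasis, hl]
        simp
      have : inner ℝ (e i) b = 0 := hmem _ hker
      simp [this]
    · rw [← T.sq_singularValues_fin rfl i]
      have := h i h0
      gcongr
  refine le_of_sq_le_sq ?_ (norm_nonneg _)
  rw [mul_pow, hsq, ← e.sum_sq_inner_right, Finset.mul_sum]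
  exact Finset.sum_le_sum fun i _ => hterm i

lemma sigmaMin_nonneg {m d : ℕ} (C : Matrix (Fin m) (Fin d) ℝ) : 0 ≤ sigmaMin C := by
  refine Real.sInf_nonneg ?_
  rintro s ⟨-, i, rfl⟩
  exact LinearMap.singularValues_nonneg _ _

lemma sigmaMin_le {m d : ℕ} (C : Matrix (Fin m) (Fin d) ℝ) {i : ℕ}
    (hi : (Matrix.toEuclideanLin C).singularValues i ≠ 0) :
    sigmaMin C ≤ (Matrix.toEuclideanLin C).singularValues i := by
  refine csInf_le ⟨0, ?_⟩ ⟨hi, i, rfl⟩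
  rintro s ⟨-, i, rfl⟩
  exact LinearMap.singularValues_nonneg _ _

lemma Matrix.frobenius_norm_sq_eq_sum_col {m n : ℕ} (A : Matrix (Fin m) (Fin n) ℝ) :
    ‖A‖ ^ 2 = ∑ j, ‖WithLp.toLp 2 (A.col j)‖ ^ 2 := by
  rw [Matrix.frobenius_norm_def, ← Real.sqrt_eq_rpow, Real.sq_sqrt (by positivity),
    Finset.sum_comm]
  refine Finset.sum_congr rfl fun j _ => ?_
  rw [EuclideanSpace.norm_sq_eq]
  simp

lemma toEuclideanLin_mem_colSpan {m d : ℕ} (C : Matrix (Fin m) (Fin d) ℝ)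
    (b : EuclideanSpace ℝ (Fin d)) : Matrix.toEuclideanLin C b ∈ colSpan C := by
  have : Matrix.toEuclideanLin C b = ∑ j, b j • WithLp.toLp 2 (C.col j) := by
    ext i
    simp [Matrix.toLpLin_apply, Matrix.mulVec, dotProduct, mul_comm]
  rw [this]
  exact Submodule.sum_mem _ fun j _ => Submodule.smul_mem _ _ (Submodule.subset_span ⟨j, rfl⟩)

lemma toLp_col_mul {l m n : ℕ} (X : Matrix (Fin l) (Fin m) ℝ) (A : Matrix (Fin m) (Fin n) ℝ)
    (j : Fin n) :
    WithLp.toLp 2 ((X * A).col j) = Matrix.toEuclideanLin X (WithLp.toLp 2 (A.col j)) := by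
  ext i
  simp [Matrix.toLpLin_apply, Matrix.mulVec, dotProduct, Matrix.mul_apply]

/-- If `C b = a`, the residual of `a` off the column span of `C + G` is at most `‖G b‖`. -/
lemma norm_residual_le {m d : ℕ} (C G : Matrix (Fin m) (Fin d) ℝ)
    (b : EuclideanSpace ℝ (Fin d)) :
    ‖Matrix.toEuclideanLin (1 - colProj (C + G)) (Matrix.toEuclideanLin C b)‖ ≤
      ‖Matrix.toEuclideanLin G b‖ := by
  have h1 : ∀ a, Matrix.toEuclideanLin (1 - colProj (C + G)) a =
      (colSpan (C + G))ᗮ.starProjection a := by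
    intro a
    rw [Submodule.starProjection_orthogonal', map_sub, colProj, LinearEquiv.apply_symm_apply]
    simp
  have h2 : (colSpan (C + G))ᗮ.starProjection (Matrix.toEuclideanLin (C + G) b) = 0 := by
    rw [Submodule.starProjection_orthogonal', sub_apply, one_apply_eq_self,
      Submodule.starProjection_eq_self_iff.2 (toEuclideanLin_mem_colSpan (C + G) b), sub_self]
  have h3 : Matrix.toEuclideanLin C b =
      Matrix.toEuclideanLin (C + G) b - Matrix.toEuclideanLin G b := by
    simp
  rw [h1, h3, map_sub, h2, zero_sub, norm_neg]
  exact Submodule.norm_starProjection_apply_le _ _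

/-- If every column of `A` lies in the column space of `C`, there are coefficient vectors `b j`
for the columns of `A` of size at most `‖A‖ / sigmaMin C`, and these control the residual. -/
lemma exists_coeff_residual_le {m n d : ℕ} (A : Matrix (Fin m) (Fin n) ℝ)
    (C : Matrix (Fin m) (Fin d) ℝ) (X : Matrix (Fin d) (Fin n) ℝ) (hA : A = C * X) :
    ∃ b : Fin n → EuclideanSpace ℝ (Fin d),
      sigmaMin C ^ 2 * ∑ j, ‖b j‖ ^ 2 ≤ ‖A‖ ^ 2 ∧
      ∀ G : Matrix (Fin m) (Fin d) ℝ, ‖(1 - colProj (C + G)) * A‖ ^ 2 ≤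
        ∑ j, ‖Matrix.toEuclideanLin G (b j)‖ ^ 2 := by
  choose b hb hb' using fun j : Fin n =>
    (Matrix.toEuclideanLin C).exists_apply_eq_and_mul_norm_le (sigmaMin_nonneg C)
      (fun i hi => sigmaMin_le C hi) (WithLp.toLp 2 (X.col j))
  refine ⟨b, ?_, fun G => ?_⟩
  · rw [Matrix.frobenius_norm_sq_eq_sum_col, Finset.mul_sum]
    refine Finset.sum_le_sum fun j _ => ?_
    rw [← mul_pow, hA, toLp_col_mul]
    have := sigmaMin_nonneg C
    exact pow_le_pow_left₀ (by positivity) (hb' j) 2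
  · rw [Matrix.frobenius_norm_sq_eq_sum_col]
    refine Finset.sum_le_sum fun j _ => ?_
    rw [toLp_col_mul, hA, toLp_col_mul, ← hb]
    exact pow_le_pow_left₀ (norm_nonneg _) (norm_residual_le C G (b j)) 2

lemma Matrix.exists_mul_eq_of_rank_eq {r d n : ℕ} (W : Matrix (Fin r) (Fin d) ℝ)
    (hW : W.rank = r) (M : Matrix (Fin r) (Fin n) ℝ) :
    ∃ X : Matrix (Fin d) (Fin n) ℝ, W * X = M := by
  have hsurj : Function.Surjective W.mulVecLin := by
    rw [← LinearMap.range_eq_top]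
    apply Submodule.eq_top_of_finrank_eq
    rw [← Matrix.rank, hW]; simp
  choose x hx using fun j => hsurj (M.col j)
  refine ⟨Matrix.of fun i j => x j i, ?_⟩
  ext i j
  have := congrFun (hx j) i
  simpa [Matrix.mulVec, dotProduct, Matrix.mul_apply] using this

/-! ### Gaussian tail bound -/

/-- The rate `1 / (4 * v)` is half the critical one: tilting turns the density into an unnormalised
Gaussian of variance `2 * v`, whence the factor `√2`. -/
lemma integral_exp_sq_div_gaussianReal {v : NNReal} (hv : v ≠ 0) :
    ∫ x, Real.exp (x ^ 2 / (4 * v)) ∂(gaussianReal 0 v) = √2 := by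
  have hv' : (0 : ℝ) < v := by positivity
  rw [integral_gaussianReal_eq_integral_smul hv]
  have : ∀ x : ℝ, gaussianPDFReal 0 v x • Real.exp (x ^ 2 / (4 * v)) =
      (√(2 * Real.pi * v))⁻¹ * Real.exp (-(1 / (4 * v)) * x ^ 2) := by
    intro x
    rw [gaussianPDFReal, smul_eq_mul, mul_assoc, ← Real.exp_add]
    congr 2
    field_simp
    ring
  simp_rw [this]
  rw [integral_const_mul, integral_gaussian, ← Real.sqrt_inv, ← Real.sqrt_mul (by positivity)]
  congr 1
  have := Real.pi_pos
  field_simp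
  norm_num

/-- For a matrix with independent centred Gaussian entries and a unit vector `u`, the coordinates
of `G u` are independent with the same law as the entries. -/
lemma gaussianMatrix_mulVec {Ω : Type*} [MeasurableSpace Ω] {P : Measure Ω}
    [IsProbabilityMeasure P] {m d : ℕ} {v : NNReal} {G : Ω → Matrix (Fin m) (Fin d) ℝ}
    (hG_law : ∀ i j, HasLaw (fun ω => G ω i j) (gaussianReal 0 v) P)
    (hG_indep : iIndepFun (fun (p : Fin m × Fin d) ω => G ω p.1 p.2) P)
    {u : EuclideanSpace ℝ (Fin d)} (hu : ‖u‖ = 1) :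
    (∀ i, HasLaw (fun ω => Matrix.toEuclideanLin (G ω) u i) (gaussianReal 0 v) P) ∧
      iIndepFun (fun i ω => Matrix.toEuclideanLin (G ω) u i) P := by
  have hgl : ∀ p : Fin m × Fin d, HasGaussianLaw (fun ω => G ω p.1 p.2) P := fun p =>
    (hG_law p.1 p.2).hasGaussianLaw
  have hjoint := hG_indep.hasGaussianLaw hgl
  have hmem : ∀ i k, MemLp (fun ω => G ω i k) 2 P := fun i k => (hgl (i, k)).memLp_two
  have happ : ∀ i ω, Matrix.toEuclideanLin (G ω) u i = ∑ k, u k * G ω i k := by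
    intro i ω
    simp [Matrix.toLpLin_apply, Matrix.mulVec, dotProduct, mul_comm]
  simp_rw [happ]
  -- Joint Gaussianity is what lets vanishing covariances give independence below.
  have hZ : HasGaussianLaw (fun ω (i : Fin m) => ∑ k, u k * G ω i k) P := by
    let L : (Fin m × Fin d → ℝ) →L[ℝ] (Fin m → ℝ) :=
      ContinuousLinearMap.pi fun i => ∑ k, u k • ContinuousLinearMap.proj (i, k)
    have hL : (fun ω (i : Fin m) => ∑ k, u k * G ω i k) =
        L ∘ fun ω (p : Fin m × Fin d) => G ω p.1 p.2 := by
      funext ω i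
      simp [L]
    rw [hL]
    exact hjoint.map L
  have hmemZ : ∀ i k, MemLp (fun ω => u k * G ω i k) 2 P := fun i k => (hmem i k).const_mul _
  have hcovG : ∀ i i' k l, cov[fun ω => G ω i k, fun ω => G ω i' l; P] =
      if (i, k) = (i', l) then (v : ℝ) else 0 := by
    intro i i' k l
    split_ifs with h
    · obtain ⟨rfl, rfl⟩ := Prod.mk.inj h
      rw [covariance_self (hG_law i k).aemeasurable, (hG_law i k).variance_eq]
      simp
    · exact (hG_indep.indepFun h).covariance_eq_zero (hmem i k) (hmem i' l)
  have hcov : ∀ i i', cov[fun ω => ∑ k, u k * G ω i k, fun ω => ∑ k, u k * G ω i' k; P] =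
      if i = i' then (v : ℝ) else 0 := by
    intro i i'
    rw [covariance_fun_sum_fun_sum (fun k => hmemZ i k) (fun k => hmemZ i' k)]
    simp_rw [covariance_const_mul_left, covariance_const_mul_right, hcovG]
    split_ifs with h
    · have hn : ∑ k, u k ^ 2 = 1 := by
        have := EuclideanSpace.norm_sq_eq u
        simpa [hu] using this.symm
      simp [h, ← mul_assoc, ← Finset.sum_mul, ← pow_two, hn]
    · simp [h]
  refine ⟨fun i => ⟨(hZ.eval i).aemeasurable, ?_⟩,
    hZ.iIndepFun_of_covariance_eq_zero fun i j hij => by rw [hcov, if_neg hij]⟩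
  rw [(hZ.eval i).map_eq_gaussianReal]
  have hmean : ∫ ω, ∑ k, u k * G ω i k ∂P = 0 := by
    rw [integral_finsetSum _ fun k _ => (hmemZ i k).integrable (by norm_num)]
    refine Finset.sum_eq_zero fun k _ => ?_
    rw [integral_const_mul, (hG_law i k).integral_eq]
    simp
  rw [hmean, ← covariance_self (hZ.eval i).aemeasurable, hcov]
  simp

lemma integral_exp_norm_sq_gaussianMatrix {Ω : Type*} [MeasurableSpace Ω] {P : Measure Ω}
    [IsProbabilityMeasure P] {m d : ℕ} {v : NNReal} (hv : v ≠ 0)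
    {G : Ω → Matrix (Fin m) (Fin d) ℝ}
    (hG_law : ∀ i j, HasLaw (fun ω => G ω i j) (gaussianReal 0 v) P)
    (hG_indep : iIndepFun (fun (p : Fin m × Fin d) ω => G ω p.1 p.2) P)
    {u : EuclideanSpace ℝ (Fin d)} (hu : ‖u‖ = 1) :
    ∫ ω, Real.exp (‖Matrix.toEuclideanLin (G ω) u‖ ^ 2 / (4 * v)) ∂P = √2 ^ m := by
  obtain ⟨hlaw, hind⟩ := gaussianMatrix_mulVec hG_law hG_indep hu
  have : ∀ ω, Real.exp (‖Matrix.toEuclideanLin (G ω) u‖ ^ 2 / (4 * v)) =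
      ∏ i, Real.exp (Matrix.toEuclideanLin (G ω) u i ^ 2 / (4 * v)) := by
    intro ω
    rw [← Real.exp_sum, EuclideanSpace.norm_sq_eq, Finset.sum_div]
    simp
  simp_rw [this]
  rw [hind.integral_fun_prod_comp (f := fun _ x => Real.exp (x ^ 2 / (4 * v)))
    (fun i => (hlaw i).aemeasurable)
    (fun i => (by fun_prop : Measurable fun x : ℝ =>
      Real.exp (x ^ 2 / (4 * v))).aestronglyMeasurable)]
  have h2 : ∀ i, ∫ ω, Real.exp (Matrix.toEuclideanLin (G ω) u i ^ 2 / (4 * v)) ∂P = √2 := by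
    intro i
    rw [← integral_exp_sq_div_gaussianReal hv]
    exact (hlaw i).integral_comp (f := fun x : ℝ => Real.exp (x ^ 2 / (4 * v)))
      (by fun_prop : Measurable fun x : ℝ =>
        Real.exp (x ^ 2 / (4 * v))).aestronglyMeasurable
  simp_rw [h2]
  simp

/-- The crude bound `√2 ≤ e` suffices, because `(1 + δ) ^ 2 - δ ^ 2 / 2 ≥ 1`. -/
lemma sqrt_two_pow_le_exp (m : ℕ) {δ : ℝ} (hδ : 0 ≤ δ) :
    √2 ^ m ≤ Real.exp (-(m * δ ^ 2) / 2) * Real.exp ((1 + δ) ^ 2 * m) := by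
  have h : √2 ≤ Real.exp 1 := by
    have h1 : √2 ≤ 2 := by rw [Real.sqrt_le_left (by norm_num)]; norm_num
    linarith [Real.add_one_le_exp (1 : ℝ)]
  calc √2 ^ m ≤ Real.exp 1 ^ m := by gcongr
    _ = Real.exp m := by rw [← Real.exp_nat_mul]; simp
    _ ≤ _ := by
      rw [← Real.exp_add]
      gcongr
      have : (0 : ℝ) ≤ m := by positivity
      nlinarith [mul_nonneg this hδ, mul_nonneg this (sq_nonneg δ)]

/-- Chernoff bound for `∑ ‖G b j‖ ^ 2`, with `G` a Gaussian matrix. -/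
lemma measureReal_sum_norm_sq_gaussianMatrix_lt {Ω : Type*} [MeasurableSpace Ω] {P : Measure Ω}
    [IsProbabilityMeasure P] {m n d : ℕ} {v : NNReal} {G : Ω → Matrix (Fin m) (Fin d) ℝ}
    (hG_law : ∀ i j, HasLaw (fun ω => G ω i j) (gaussianReal 0 v) P)
    (hG_indep : iIndepFun (fun (p : Fin m × Fin d) ω => G ω p.1 p.2) P)
    (b : Fin n → EuclideanSpace ℝ (Fin d)) {δ : ℝ} (hδ : 0 ≤ δ) :
    P.real {ω | 4 * (1 + δ) ^ 2 * m * v * ∑ j, ‖b j‖ ^ 2 <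
      ∑ j, ‖Matrix.toEuclideanLin (G ω) (b j)‖ ^ 2} ≤ Real.exp (-(m * δ ^ 2) / 2) := by
  set N := ∑ j, ‖b j‖ ^ 2 with hN
  have hN0 : 0 ≤ N := by positivity
  rcases eq_or_ne v 0 with rfl | hv
  · have hG0 : ∀ᵐ ω ∂P, ∀ i j, G ω i j = 0 := by
      simp_rw [ae_all_iff]
      intro i j
      have := hG_law i j
      rw [gaussianReal_zero_var] at this
      exact this.ae_eq_of_dirac
    have : P {ω | 4 * (1 + δ) ^ 2 * m * ((0 : NNReal) : ℝ) * N <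
        ∑ j, ‖Matrix.toEuclideanLin (G ω) (b j)‖ ^ 2} = 0 := by
      refine measure_eq_zero_iff_ae_notMem.2 ?_
      filter_upwards [hG0] with ω hω
      have : G ω = 0 := by ext i j; exact hω i j
      simp [this]
    rw [Measure.real, this]
    simpa using (Real.exp_pos _).le
  rcases hN0.eq_or_lt with hN0 | hN0
  · have hb : ∀ j, b j = 0 := by
      intro j
      have := (Finset.sum_eq_zero_iff_of_nonneg (fun j _ => sq_nonneg ‖b j‖)).1
        (hN.symm.trans hN0.symm) j (Finset.mem_univ j)
      simpa using this
    simp [hb, ← hN0, Real.exp_nonneg]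
  have hv' : (0 : ℝ) < v := by positivity
  -- normalised directions
  set p : Fin n → ℝ := fun j => ‖b j‖ ^ 2 / N with hp
  have hp1 : ∑ j, p j = 1 := by
    rw [hp, ← Finset.sum_div, ← hN, div_self hN0.ne']
  set u : Fin n → EuclideanSpace ℝ (Fin d) := fun j => ‖b j‖⁻¹ • b j with hu
  -- If `b j = 0` then `u j = 0` is not a unit vector; such indices have weight zero and are
  -- dropped.
  set S : Finset (Fin n) := Finset.univ.filter fun j => b j ≠ 0 with hS
  have hpS : ∀ f : Fin n → ℝ, ∑ j ∈ S, p j * f j = ∑ j, p j * f j := by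
    intro f
    refine Finset.sum_subset (Finset.subset_univ _) fun j _ hj => ?_
    have : b j = 0 := by simpa [hS] using hj
    simp [hp, this]
  set Y : Fin n → Ω → ℝ := fun j ω => ‖Matrix.toEuclideanLin (G ω) (u j)‖ ^ 2 / (4 * v) with hY
  have hEY : ∀ j ∈ S, ∫ ω, Real.exp (Y j ω) ∂P = √2 ^ m := by
    intro j hj
    have hbj : b j ≠ 0 := by simpa [hS] using hj
    refine integral_exp_norm_sq_gaussianMatrix hv hG_law hG_indep ?_
    rw [hu, norm_smul, norm_inv, norm_norm, inv_mul_cancel₀ (norm_ne_zero_iff.2 hbj)]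
  have hint : ∀ j ∈ S, Integrable (fun ω => Real.exp (Y j ω)) P := by
    intro j hj
    -- A non-integrable function has integral `0` by convention, so a nonzero value proves
    -- integrability.
    refine not_imp_comm.1 integral_undef ?_
    rw [hEY j hj]
    positivity
  have hsum : ∀ ω, ∑ j, ‖Matrix.toEuclideanLin (G ω) (b j)‖ ^ 2 =
      4 * v * N * ∑ j ∈ S, p j * Y j ω := by
    intro ω
    rw [hpS fun j => Y j ω, Finset.mul_sum]
    refine Finset.sum_congr rfl fun j _ => ?_
    simp only [hp, hY, hu]
    by_cases hbj : b j = 0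
    · simp [hbj]
    · have : ‖b j‖ ≠ 0 := norm_ne_zero_iff.2 hbj
      rw [map_smul, norm_smul, norm_inv, norm_norm]
      field_simp
  -- Jensen's inequality replaces any independence between different `j`.
  have hJ : ∀ ω, Real.exp (∑ j ∈ S, p j * Y j ω) ≤ ∑ j ∈ S, p j * Real.exp (Y j ω) := by
    intro ω
    have := convexOn_exp.map_sum_le (t := S) (w := p) (p := fun j => Y j ω)
      (fun j _ => by simp only [hp]; positivity)
      (by have := hpS fun _ => 1; simp only [mul_one] at this; rw [this, hp1])
      (fun _ _ => Set.mem_univ _)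
    simpa using this
  set F : Ω → ℝ := fun ω => ∑ j ∈ S, p j * Real.exp (Y j ω) with hF
  have hFint : Integrable F P := integrable_finsetSum _ fun j hj => (hint j hj).const_mul _
  have hFE : ∫ ω, F ω ∂P = √2 ^ m := by
    rw [hF, integral_finsetSum _ fun j hj => (hint j hj).const_mul _]
    have : ∀ j ∈ S, ∫ ω, p j * Real.exp (Y j ω) ∂P = p j * √2 ^ m := fun j hj => by
      rw [integral_const_mul, hEY j hj]
    rw [Finset.sum_congr rfl this, hpS fun _ => √2 ^ m, ← Finset.sum_mul, hp1, one_mul]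
  have hF0 : 0 ≤ F := fun ω => Finset.sum_nonneg fun j _ => by simp only [hp]; positivity
  have hmarkov := mul_meas_ge_le_integral_of_nonneg (ae_of_all P hF0) hFint
    (Real.exp ((1 + δ) ^ 2 * m))
  rw [hFE] at hmarkov
  have hsub : {ω | 4 * (1 + δ) ^ 2 * m * v * N <
      ∑ j, ‖Matrix.toEuclideanLin (G ω) (b j)‖ ^ 2} ⊆ {ω | Real.exp ((1 + δ) ^ 2 * m) ≤ F ω} := by
    intro ω hω
    refine le_trans ?_ (hJ ω)
    rw [Set.mem_ofPred_eq, hsum] at hω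
    have : (1 + δ) ^ 2 * m < ∑ j ∈ S, p j * Y j ω := by
      refine lt_of_mul_lt_mul_left (a := 4 * v * N) ?_ (by positivity)
      linarith
    exact Real.exp_le_exp.2 this.le
  refine (measureReal_mono hsub).trans ?_
  have := hmarkov.trans (sqrt_two_pow_le_exp m hδ)
  rw [mul_comm] at this
  exact le_of_mul_le_mul_right this (Real.exp_pos _)

/-- Squaring the singular value hypothesis produces the constant. Nothing is divided by `s`, so `s =
0` needs no separate case. -/
lemma threshold_le {σ δ ε m s N a : ℝ} (hσ : 0 ≤ σ) (hδ : 0 ≤ δ) (hε : 0 < ε) (hm : 0 ≤ m)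
    (hN : 0 ≤ N) (hs : 2 * (1 + δ) * σ * √(m / ε) ≤ s) (ha : s ^ 2 * N ≤ a) :
    4 * (1 + δ) ^ 2 * m * σ ^ 2 * N ≤ ε * a := by
  have hsq := pow_le_pow_left₀ (by positivity) hs 2
  rw [mul_pow, Real.sq_sqrt (by positivity)] at hsq
  calc 4 * (1 + δ) ^ 2 * m * σ ^ 2 * N = ε * (((2 * (1 + δ) * σ) ^ 2 * (m / ε)) * N) := by
        field_simp; ring
    _ ≤ ε * (s ^ 2 * N) := by gcongr
    _ ≤ ε * a := by gcongr

theorem mainTheorem2 {Ω : Type*} [MeasurableSpace Ω] (P : Measure Ω) [IsProbabilityMeasure P]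
    (m n d r : ℕ) (σ δ ε : ℝ) (hσ : 0 ≤ σ) (hδ : 0 ≤ δ) (hε : 0 < ε)
    (U : Matrix (Fin m) (Fin r) ℝ) (hU : U.transpose * U = 1)
    (M : Matrix (Fin r) (Fin n) ℝ) (hM : M.rank = r)
    (W : Matrix (Fin r) (Fin d) ℝ) (hW : W.rank = r)
    (A : Matrix (Fin m) (Fin n) ℝ) (hA : A = U * M)
    (C : Matrix (Fin m) (Fin d) ℝ) (hC : C = U * W)
    (G : Ω → Matrix (Fin m) (Fin d) ℝ)
    (hG_law : ∀ i j, HasLaw (fun ω => G ω i j) (gaussianReal 0 (Real.toNNReal (σ ^ 2))) P)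
    (hG_indep : iIndepFun (fun (p : Fin m × Fin d) ω => G ω p.1 p.2) P)
    (hC_min : 2 * (1 + δ) * σ * Real.sqrt (m / ε) ≤ sigmaMin C) :
    1 - Real.exp (-(m * δ ^ 2) / 2) ≤
      P.real {ω | ‖(1 - colProj (C + G ω)) * A‖ ^ 2 ≤ ε * ‖A‖ ^ 2} := by
  obtain ⟨X, hX⟩ := W.exists_mul_eq_of_rank_eq hW M
  obtain ⟨b, hb, hres⟩ := exists_coeff_residual_le A C X (by rw [hA, hC, ← hX, Matrix.mul_assoc])
  have hbad := measureReal_sum_norm_sq_gaussianMatrix_lt hG_law hG_indep b hδ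
  rw [Real.coe_toNNReal _ (sq_nonneg σ)] at hbad
  set B := {ω | 4 * (1 + δ) ^ 2 * m * σ ^ 2 * ∑ j, ‖b j‖ ^ 2 <
    ∑ j, ‖Matrix.toEuclideanLin (G ω) (b j)‖ ^ 2}
  have hthr : 4 * (1 + δ) ^ 2 * m * σ ^ 2 * ∑ j, ‖b j‖ ^ 2 ≤ ε * ‖A‖ ^ 2 := by
    exact threshold_le hσ hδ hε m.cast_nonneg (Finset.sum_nonneg fun j _ => sq_nonneg _) hC_min hb
  -- Covering the space and using subadditivity avoids proving that the good event is measurable.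
  have hcover : Set.univ ⊆ {ω | ‖(1 - colProj (C + G ω)) * A‖ ^ 2 ≤ ε * ‖A‖ ^ 2} ∪ B := by
    intro ω _
    by_cases hω : ω ∈ B
    · exact Or.inr hω
    · exact Or.inl (((hres (G ω)).trans (not_lt.1 hω)).trans hthr)
  have h1 := (measureReal_mono (μ := P) hcover).trans (measureReal_union_le _ _)
  rw [probReal_univ] at h1
  linarith
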